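/- Let $\mathbb K=\mathbb R$ or $\mathbb C$, and let $G$ be an analytic local Lie group with $r$ parameters, that is, a composition law $(a,b)\mapsto ab$ on $\mathbb K^r$, analytic near a point $(e,e)$, satisfying the unit and associativity laws near $e$. A representation $\Gamma$ of $G$ in $n$ variables is a continuous transformation group $x'=f(x,a)$ of a nonempty open set $\Omega\subseteq\mathbb K^n$, with $f$ analytic near $\Omega\times\{e\}$, $f(x,e)=x$, and $f(f(x,a),b)=f(x,ab)$ for $a,b$ near $e$ (locally uniformly in $x$). It is called proper if its infinitesimal operators $X_i=\frac{\partial f}{\partial a_i}(\cdot,e)$, $i=1,\dots,r$, are linearly independent over the constants as vector fields on $\Omega$. The power $\Gamma^m$ is the representation of $G$ on $\Omega^m$ (in $mn$ variables) in which each transformation acts with the same parameter values on each of the $m$ copies of $\Omega$. A representation $\Gamma$ on $\Omega$ contains a representation $\Gamma':\ y'=f'(y,a)$ on $\Omega'\subseteq\mathbb K^s$ if for every $y\in\Omega'$ there are an open set $U\subseteq\Omega$ and an analytic map $\varphi:U\to\Omega'$ whose $s$ components are functionally independent (its derivative is surjective at every point of $U$), with $y\in\varphi(U)$, and with $\varphi(f(x,a))=f'(\varphi(x),a)$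 for $x\in U$ and $a$ near $e$ (locally uniformly in $x$). Theorem (Cartan's "Archimedean" property). Let $\Gamma$ be a proper representation of $G$ in $n\ge 1$ variables, and let $\Gamma_1$ be any representation of $G$, proper or not, in $s$ variables. Then there is an integer $m\ge 1$ such that $\Gamma^m$ contains $\Gamma_1$. -/

import Mathlib

open Filter Topology

/-- An analytic local Lie group with `r` parameters (a "parametric group"): a composition law
`mul a b` of parameter systems, analytic near the identity parameters `one`, for which the unit and
associativity laws hold near the identity. (Local inverses exist by the implicit function theorem.)
Values of `mul` away from `(one, one)` are irrelevant. -/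
structure LocalLieGroup (𝕜 : Type*) [RCLike 𝕜] (r : ℕ) where
  one : Fin r → 𝕜
  mul : (Fin r → 𝕜) → (Fin r → 𝕜) → (Fin r → 𝕜)
  analyticAt_mul :
    AnalyticAt 𝕜 (fun p : (Fin r → 𝕜) × (Fin r → 𝕜) => mul p.1 p.2) (one, one)
  one_mul : ∀ᶠ a in 𝓝 one, mul one a = a
  mul_one : ∀ᶠ a in 𝓝 one, mul a one = a
  mul_assoc : ∀ᶠ p : (Fin r → 𝕜) × (Fin r → 𝕜) × (Fin r → 𝕜) in 𝓝 (one, one, one),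
    mul (mul p.1 p.2.1) p.2.2 = mul p.1 (mul p.2.1 p.2.2)

/-- A representation of the local Lie group `G` as a continuous transformation group
`x' = f (x, a)` of a nonempty open set `domain` of the coordinate space `E`:
`f` is analytic near `domain × {one}`, the identity parameters give the identity transformation,
and `f (f (x, a), b) = f (x, a b)` for `a`, `b` near the identity, locally uniformly in `x`.
No faithfulness is required. Values of `act` away from `domain × {one}` are irrelevant. -/
structure LocalRep {𝕜 : Type*} [RCLike 𝕜] {r : ℕ} (G : LocalLieGroup 𝕜 r)
    (E : Type*) [NormedAddCommGroup E] [NormedSpace 𝕜 E] where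
  domain : Set E
  isOpen_domain : IsOpen domain
  nonempty_domain : domain.Nonempty
  act : E → (Fin r → 𝕜) → E
  analyticAt_act : ∀ x ∈ domain,
    AnalyticAt 𝕜 (fun p : E × (Fin r → 𝕜) => act p.1 p.2) (x, G.one)
  act_one : ∀ x ∈ domain, act x G.one = x
  act_act : ∀ x ∈ domain,
    ∀ᶠ p : E × (Fin r → 𝕜) × (Fin r → 𝕜) in 𝓝 (x, G.one, G.one),
      act (act p.1 p.2.1) p.2.2 = act p.1 (G.mul p.2.1 p.2.2)

namespace LocalRep

variable {𝕜 : Type*} [RCLike 𝕜] {r : ℕ} {G : LocalLieGroup 𝕜 r}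
  {E : Type*} [NormedAddCommGroup E] [NormedSpace 𝕜 E]
  {F : Type*} [NormedAddCommGroup F] [NormedSpace 𝕜 F]

/-- The `i`-th infinitesimal operator `X i`, as a vector field on the domain: the derivative of
`act x a` in the `i`-th parameter at the identity. -/
noncomputable def infOp (Γ : LocalRep G E) (i : Fin r) : Γ.domain → E :=
  fun x => fderiv 𝕜 (fun a => Γ.act x a) G.one (Pi.single i 1)

/-- The representation is proper (faithful; its `r` parameters are essential): no nontrivial linear
combination of the infinitesimal operators with constant coefficients vanishes identically. -/
def IsProper (Γ : LocalRep G E) : Prop :=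
  LinearIndependent 𝕜 Γ.infOp

/-- The power `Γ ^ m`: the same transformation acts on each of `m` copies of the space. -/
def power (Γ : LocalRep G E) (m : ℕ) : LocalRep G (Fin m → E) where
  domain := Set.univ.pi fun _ => Γ.domain
  isOpen_domain := isOpen_set_pi Set.finite_univ fun _ _ => Γ.isOpen_domain
  nonempty_domain := Set.univ_pi_nonempty_iff.2 fun _ => Γ.nonempty_domain
  act := fun x a j => Γ.act (x j) a
  analyticAt_act := by
    intro x hx
    rw [analyticAt_pi_iff]
    intro j
    have h : AnalyticAt 𝕜 (fun p : (Fin m → E) × (Fin r → 𝕜) => (p.1 j, p.2)) (x, G.one) :=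
      (((ContinuousLinearMap.proj (R := 𝕜) (φ := fun _ : Fin m => E) j).comp
        (ContinuousLinearMap.fst 𝕜 (Fin m → E) (Fin r → 𝕜))).analyticAt _).prod
        ((ContinuousLinearMap.snd 𝕜 (Fin m → E) (Fin r → 𝕜)).analyticAt _)
    exact AnalyticAt.comp (g := fun p : E × (Fin r → 𝕜) => Γ.act p.1 p.2)
      (f := fun p : (Fin m → E) × (Fin r → 𝕜) => (p.1 j, p.2))
      (Γ.analyticAt_act (x j) (hx j trivial)) h
  act_one := fun x hx => funext fun j => Γ.act_one (x j) (hx j trivial)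
  act_act := by
    intro x hx
    have h : ∀ j : Fin m, ∀ᶠ p : (Fin m → E) × (Fin r → 𝕜) × (Fin r → 𝕜) in
        𝓝 (x, G.one, G.one), Γ.act (Γ.act (p.1 j) p.2.1) p.2.2
          = Γ.act (p.1 j) (G.mul p.2.1 p.2.2) := by
      intro j
      have hc : Tendsto (fun p : (Fin m → E) × (Fin r → 𝕜) × (Fin r → 𝕜) => (p.1 j, p.2))
          (𝓝 (x, G.one, G.one)) (𝓝 (x j, G.one, G.one)) :=
        Continuous.tendsto (by fun_prop) (x, G.one, G.one)
      exact hc.eventually (Γ.act_act (x j) (hx j trivial))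
    filter_upwards [eventually_all.2 h] with p hp
    exact funext hp

/-- `Γ` contains `Γ'`: near every point `y` of its domain, `Γ'` is obtained from `Γ` by an analytic
substitution `y = φ x`, defined on some open part `U` of the domain of `Γ`, whose components are
functionally independent (the derivative of `φ` is onto), and such that
`φ (f (x, a)) = f' (φ x, a)` for all parameters `a` near the identity, locally uniformly in `x`. -/
def Contains (Γ : LocalRep G E) (Γ' : LocalRep G F) : Prop :=
  ∀ y ∈ Γ'.domain, ∃ (U : Set E) (φ : E → F),
    IsOpen U ∧ U ⊆ Γ.domain ∧ AnalyticOnNhd 𝕜 φ U ∧ Set.MapsTo φ U Γ'.domain ∧ y ∈ φ '' U ∧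
    (∀ x ∈ U, Function.Surjective (fderiv 𝕜 φ x)) ∧
    ∀ x ∈ U, ∀ᶠ p : E × (Fin r → 𝕜) in 𝓝 (x, G.one),
      φ (Γ.act p.1 p.2) = Γ'.act (φ p.1) p.2

end LocalRep

/-! Properness says that every nonzero parameter direction has nonzero orbit derivative at some
point of the domain. In finite dimension finitely many points detect all directions, so on a high
enough power of `Γ` some orbit map is an immersion (`exists_injective_orbitDeriv_power`). Near such
a point each `z` is uniquely `act u a` with `u` on a slice transverse to the orbits, and acting by
`b` keeps `u` and turns `a` into `mul a b` (`exists_slice_coordinates`). Hence any analytic map `h`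
from the slice to the target extends equivariantly by sending `act u a` to `Γ'.act (h u) a`. Further
copies make the slice dimension `m * n - r` at least `s`, so that `h` can be taken submersive
(`contains_of_transversal`). -/

/-- Surjectivity of the derivative onto a complete space, when witnessed by a continuous right
inverse, persists near the point. -/
theorem ContinuousAt.eventually_surjective_of_comp_eq_id {𝕜 X E F : Type*}
    [NontriviallyNormedField 𝕜] [TopologicalSpace X] [NormedAddCommGroup E] [NormedSpace 𝕜 E]
    [NormedAddCommGroup F] [NormedSpace 𝕜 F] [CompleteSpace F] {D : X → E →L[𝕜] F} {x : X}
    (hD : ContinuousAt D x) {R : F →L[𝕜] E} (hR : (D x).comp R = ContinuousLinearMap.id 𝕜 F) :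
    ∀ᶠ z in 𝓝 x, Function.Surjective (D z) := by
  have hc : ContinuousAt (fun z => (D z).comp R) x := hD.clm_comp continuousAt_const
  have hu : ∀ᶠ z in 𝓝 x, IsUnit ((D z).comp R) := by
    refine hc.eventually_mem (Units.isOpen.mem_nhds ?_)
    change IsUnit ((D x).comp R)
    rw [hR]
    exact isUnit_one
  filter_upwards [hu] with z hz
  obtain ⟨u, hu⟩ := hz
  intro w
  refine ⟨R ((↑u⁻¹ : F →L[𝕜] F) w), ?_⟩
  change ((D z).comp R) ((↑u⁻¹ : F →L[𝕜] F) w) = w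
  rw [← hu]
  change ((u : F →L[𝕜] F) * (↑u⁻¹ : F →L[𝕜] F)) w = w
  simp

/-- Analytic inverse function theorem. -/
theorem AnalyticAt.exists_analyticAt_localInverse {𝕜 E F : Type*} [RCLike 𝕜]
    [NormedAddCommGroup E] [NormedSpace 𝕜 E] [CompleteSpace E]
    [NormedAddCommGroup F] [NormedSpace 𝕜 F] {f : E → F} {x : E} {e : E ≃L[𝕜] F}
    (hf : AnalyticAt 𝕜 f x) (he : HasFDerivAt f (e : E →L[𝕜] F) x) :
    ∃ g : F → E, AnalyticAt 𝕜 g (f x) ∧ g (f x) = x ∧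
      (∀ᶠ z in 𝓝 x, g (f z) = z) ∧ ∀ᶠ y in 𝓝 (f x), f (g y) = y := by
  have hs : HasStrictFDerivAt f (e : E →L[𝕜] F) x := by
    have := hf.hasStrictFDerivAt
    rwa [he.fderiv] at this
  refine ⟨hs.localInverse f e x, ?_, hs.localInverse_apply_image, hs.eventually_left_inverse,
    hs.eventually_right_inverse⟩
  exact (hs.toOpenPartialHomeomorph f).analyticAt_symm' hs.mem_toOpenPartialHomeomorph_source hf
    he.fderiv

/-- A well-founded family of submodules is cut down to its intersection by finitely many members. -/
theorem Submodule.exists_finset_inf_le {R M ι : Type*} [Ring R] [AddCommGroup M] [Module R M]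
    [IsArtinian R M] (K : ι → Submodule R M) : ∃ S : Finset ι, ∀ i, S.inf K ≤ K i := by
  classical
  obtain ⟨_, ⟨S, rfl⟩, hS⟩ := (wellFounded_lt (α := Submodule R M)).has_min
    (Set.range fun S : Finset ι => S.inf K) (Set.range_nonempty _)
  refine ⟨S, fun i => ?_⟩
  by_contra hi
  refine hS _ ⟨insert i S, rfl⟩ ?_
  simp only [Finset.inf_insert]
  exact inf_lt_right.2 hi

namespace LocalRep

variable {𝕜 : Type*} [RCLike 𝕜] {r : ℕ} {G : LocalLieGroup 𝕜 r}
  {E : Type*} [NormedAddCommGroup E] [NormedSpace 𝕜 E]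
  {F : Type*} [NormedAddCommGroup F] [NormedSpace 𝕜 F]

/-- The derivative of the orbit map at the identity parameters. -/
noncomputable def orbitDeriv (Γ : LocalRep G E) (x : E) : (Fin r → 𝕜) →L[𝕜] E :=
  fderiv 𝕜 (fun a => Γ.act x a) G.one

theorem analyticAt_orbit (Γ : LocalRep G E) {x : E} (hx : x ∈ Γ.domain) :
    AnalyticAt 𝕜 (fun a => Γ.act x a) G.one :=
  AnalyticAt.comp (g := fun p : E × (Fin r → 𝕜) => Γ.act p.1 p.2) (f := fun a => (x, a))
    (Γ.analyticAt_act x hx) (analyticAt_const.prod analyticAt_id)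

/-- The two partial derivatives determine the total one, and the spatial one is the identity because
`act · G.one` fixes all points near `x`. -/
theorem hasFDerivAt_act (Γ : LocalRep G E) {x : E} (hx : x ∈ Γ.domain) :
    HasFDerivAt (fun p : E × (Fin r → 𝕜) => Γ.act p.1 p.2)
      (ContinuousLinearMap.fst 𝕜 E (Fin r → 𝕜) +
        (Γ.orbitDeriv x).comp (ContinuousLinearMap.snd 𝕜 E (Fin r → 𝕜))) (x, G.one) := by
  have hd := (Γ.analyticAt_act x hx).differentiableAt.hasFDerivAt
  set D := fderiv 𝕜 (fun p : E × (Fin r → 𝕜) => Γ.act p.1 p.2) (x, G.one)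
  have h1 : D.comp (ContinuousLinearMap.inl 𝕜 E (Fin r → 𝕜)) = ContinuousLinearMap.id 𝕜 E := by
    have h := HasFDerivAt.comp (f := fun z : E => (z, G.one)) x hd (hasFDerivAt_prodMk_left x G.one)
    refine h.unique ((hasFDerivAt_id x).congr_of_eventuallyEq ?_)
    filter_upwards [Γ.isOpen_domain.mem_nhds hx] with z hz using Γ.act_one z hz
  have h2 : D.comp (ContinuousLinearMap.inr 𝕜 E (Fin r → 𝕜)) = Γ.orbitDeriv x :=
    (HasFDerivAt.comp (f := fun a : Fin r → 𝕜 => (x, a)) G.one hd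
      (hasFDerivAt_prodMk_right x G.one)).fderiv.symm
  have h3 : ContinuousLinearMap.fst 𝕜 E (Fin r → 𝕜) +
      (Γ.orbitDeriv x).comp (ContinuousLinearMap.snd 𝕜 E (Fin r → 𝕜)) = D := by
    refine ContinuousLinearMap.ext fun p => ?_
    have e1 : D (p.1, 0) = p.1 := DFunLike.congr_fun h1 p.1
    have e2 : D (0, p.2) = Γ.orbitDeriv x p.2 := DFunLike.congr_fun h2 p.2
    have e3 : D p = D (p.1, 0) + D (0, p.2) := by rw [← map_add]; simp
    rw [e3, e1, e2]
    rfl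
  rw [h3]
  exact hd

/-- Near a point where the orbit map is an immersion, every point is uniquely of the form
`act u a` with `u` on the slice `L u = L x`; the slice coordinate is invariant and the parameter
`a` is equivariant. -/
theorem exists_slice_coordinates [CompleteSpace E] (Γ : LocalRep G E) {x : E} (hx : x ∈ Γ.domain)
    (L : E →L[𝕜] (Fin r → 𝕜))
    (hL : L.comp (Γ.orbitDeriv x) = ContinuousLinearMap.id 𝕜 (Fin r → 𝕜)) :
    ∃ (u : E → E) (A : E → Fin r → 𝕜),
      AnalyticAt 𝕜 u x ∧ AnalyticAt 𝕜 A x ∧ u x = x ∧ A x = G.one ∧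
      (∀ᶠ z in 𝓝 x, L z = L x → u z = z ∧ A z = G.one) ∧
      ∀ᶠ p : E × (Fin r → 𝕜) in 𝓝 (x, G.one),
        u (Γ.act p.1 p.2) = u p.1 ∧ A (Γ.act p.1 p.2) = G.mul (A p.1) p.2 := by
  let T := Γ.orbitDeriv x
  have hLT : ∀ c, L (T c) = c := fun c => DFunLike.congr_fun hL c
  let fs := ContinuousLinearMap.fst 𝕜 E (Fin r → 𝕜)
  let sn := ContinuousLinearMap.snd 𝕜 E (Fin r → 𝕜)
  -- The derivative of `Θ` below. If `w = v + T c` and `d = L v`, applying `L` gives `c = L w - d`,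
  -- and then `v = w - T c`.
  let e : (E × (Fin r → 𝕜)) ≃L[𝕜] (E × (Fin r → 𝕜)) :=
    ContinuousLinearEquiv.equivOfInverse ((fs + T.comp sn).prod (L.comp fs))
      ((fs - T.comp (L.comp fs - sn)).prod (L.comp fs - sn))
      (fun p => by simp [fs, sn, hLT]) (fun p => by simp [fs, sn, hLT])
  -- Inverting `Θ` with second entry frozen at `L x` solves `act u a = z` for `u` on the slice.
  let Θ : E × (Fin r → 𝕜) → E × (Fin r → 𝕜) := fun p => (Γ.act p.1 p.2, L p.1)
  have hΘa : AnalyticAt 𝕜 Θ (x, G.one) :=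
    (Γ.analyticAt_act x hx).prod ((L.comp fs).analyticAt _)
  have hΘd : HasFDerivAt Θ (e : (E × (Fin r → 𝕜)) →L[𝕜] (E × (Fin r → 𝕜))) (x, G.one) :=
    (Γ.hasFDerivAt_act hx).prodMk (L.comp fs).hasFDerivAt
  have hΘx : Θ (x, G.one) = (x, L x) := by simp [Θ, Γ.act_one x hx]
  obtain ⟨g, hga, hg0, hgl, hgr⟩ := hΘa.exists_analyticAt_localInverse hΘd
  rw [hΘx] at hga hg0 hgr
  have hgx : AnalyticAt 𝕜 (fun z => g (z, L x)) x :=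
    AnalyticAt.comp (f := fun z : E => (z, L x)) hga (analyticAt_id.prod analyticAt_const)
  have hu : AnalyticAt 𝕜 (fun z => (g (z, L x)).1) x := (fs.analyticAt _).comp hgx
  have hA : AnalyticAt 𝕜 (fun z => (g (z, L x)).2) x := (sn.analyticAt _).comp hgx
  refine ⟨fun z => (g (z, L x)).1, fun z => (g (z, L x)).2, hu, hA, by simp [hg0], by simp [hg0],
    ?_, ?_⟩
  · have hc : Tendsto (fun z : E => (z, G.one)) (𝓝 x) (𝓝 (x, G.one)) :=
      Continuous.tendsto (by fun_prop) x
    filter_upwards [hc.eventually hgl, Γ.isOpen_domain.mem_nhds hx] with z hz hzd hLz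
    simp only [Θ, Γ.act_one z hzd, hLz] at hz
    simp [hz]
  · have hc1 : Tendsto (fun p : E × (Fin r → 𝕜) => p.1) (𝓝 (x, G.one)) (𝓝 x) :=
      Continuous.tendsto continuous_fst (x, G.one)
    have hc2 : Tendsto (fun p : E × (Fin r → 𝕜) => p.2) (𝓝 (x, G.one)) (𝓝 G.one) :=
      Continuous.tendsto continuous_snd (x, G.one)
    have hut : Tendsto (fun p : E × (Fin r → 𝕜) => (g (p.1, L x)).1) (𝓝 (x, G.one)) (𝓝 x) := by
      have := hu.continuousAt.tendsto.comp hc1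
      rwa [hg0] at this
    have hAt : Tendsto (fun p : E × (Fin r → 𝕜) => (g (p.1, L x)).2) (𝓝 (x, G.one))
        (𝓝 G.one) := by
      have := hA.continuousAt.tendsto.comp hc1
      rwa [hg0] at this
    have hmt : Tendsto (fun p : E × (Fin r → 𝕜) => G.mul (g (p.1, L x)).2 p.2) (𝓝 (x, G.one))
        (𝓝 G.one) := by
      have := G.analyticAt_mul.continuousAt.tendsto.comp (hAt.prodMk_nhds hc2)
      rwa [G.mul_one.self_of_nhds] at this
    have hct : Tendsto (fun p : E × (Fin r → 𝕜) => (p.1, L x)) (𝓝 (x, G.one)) (𝓝 (x, L x)) :=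
      hc1.prodMk_nhds tendsto_const_nhds
    -- With `z = act u a`, the group law gives `act z b = act u (mul a b)` with the same `u` on the
    -- slice; local injectivity of `Θ` identifies these as the coordinates of `act z b`.
    filter_upwards [hct.eventually hgr, (hut.prodMk_nhds hmt).eventually hgl,
      (hut.prodMk_nhds (hAt.prodMk_nhds hc2)).eventually (Γ.act_act x hx)] with p h1 h2 h3
    simp only [Θ, Prod.mk.injEq] at h1 h2
    rw [h1.1] at h3
    rw [h1.2, ← h3] at h2
    simp [h2]

/-- If some orbit map is an immersion transversal to `F` independent linear invariants, then `Γ`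
contains every representation on `F`. -/
theorem contains_of_transversal [CompleteSpace E] [CompleteSpace F] (Γ : LocalRep G E) {x : E}
    (hx : x ∈ Γ.domain) (L : E →L[𝕜] (Fin r → 𝕜))
    (hL : L.comp (Γ.orbitDeriv x) = ContinuousLinearMap.id 𝕜 (Fin r → 𝕜))
    (R : F →L[𝕜] E) (H : E →L[𝕜] F) (hLR : ∀ t, L (R t) = 0) (hHR : ∀ t, H (R t) = t)
    (Γ' : LocalRep G F) : Γ.Contains Γ' := by
  intro y hy
  obtain ⟨u, A, hua, hAa, hux, hAx, hslice, hequi⟩ := Γ.exists_slice_coordinates hx L hL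
  let h : E → F := fun w => y + H (w - x)
  have hhx : h x = y := by simp [h]
  have hha : AnalyticAt 𝕜 h x :=
    analyticAt_const.add ((H.analyticAt _).comp (analyticAt_id.sub analyticAt_const))
  let φ : E → F := fun z => Γ'.act (h (u z)) (A z)
  have hφx : φ x = y := by simp [φ, hux, hAx, hhx, Γ'.act_one y hy]
  have hhu : AnalyticAt 𝕜 (fun z => h (u z)) x :=
    AnalyticAt.comp (g := h) (by rwa [hux]) hua
  have hφa : AnalyticAt 𝕜 φ x := by
    refine AnalyticAt.comp (g := fun p : F × (Fin r → 𝕜) => Γ'.act p.1 p.2)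
      (f := fun z => (h (u z), A z)) ?_ (hhu.prod hAa)
    rw [hux, hhx, hAx]
    exact Γ'.analyticAt_act y hy
  -- The line `x + R t` lies in the slice, where `φ` is just `h`; hence `φ (x + R t) = y + t` for
  -- small `t`.
  have hD : (fderiv 𝕜 φ x).comp R = ContinuousLinearMap.id 𝕜 F := by
    have hq : HasFDerivAt (fun t : F => x + R t) R 0 := R.hasFDerivAt.const_add x
    have hφd : HasFDerivAt φ (fderiv 𝕜 φ x) (x + R 0) := by
      simpa using hφa.differentiableAt.hasFDerivAt
    have hxt : Tendsto (fun t : F => x + R t) (𝓝 0) (𝓝 x) := by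
      have := hq.continuousAt.tendsto
      simpa using this
    have hyt : Tendsto (fun t : F => y + t) (𝓝 0) (𝓝 y) :=
      (Continuous.tendsto' (by fun_prop) 0 y (by simp))
    refine (HasFDerivAt.comp (f := fun t : F => x + R t) 0 hφd hq).unique
      (((hasFDerivAt_id (𝕜 := 𝕜) (0 : F)).const_add y).congr_of_eventuallyEq ?_)
    filter_upwards [hxt.eventually hslice, hyt.eventually (Γ'.isOpen_domain.mem_nhds hy)]
      with t ht hty
    obtain ⟨h1, h2⟩ := ht (by simp [hLR])
    simp only [Function.comp, φ, h1, h2, h, add_sub_cancel_left, hHR, id]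
    exact Γ'.act_one _ hty
  have hsurj : ∀ᶠ z in 𝓝 x, Function.Surjective (fderiv 𝕜 φ z) :=
    hφa.fderiv.continuousAt.eventually_surjective_of_comp_eq_id hD
  have hequiv : ∀ᶠ p : E × (Fin r → 𝕜) in 𝓝 (x, G.one), φ (Γ.act p.1 p.2) = Γ'.act (φ p.1) p.2 := by
    have hc1 : Tendsto (fun p : E × (Fin r → 𝕜) => p.1) (𝓝 (x, G.one)) (𝓝 x) :=
      Continuous.tendsto continuous_fst (x, G.one)
    have hc2 : Tendsto (fun p : E × (Fin r → 𝕜) => p.2) (𝓝 (x, G.one)) (𝓝 G.one) :=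
      Continuous.tendsto continuous_snd (x, G.one)
    have h1 := hhu.continuousAt.tendsto.comp hc1
    have h2 := hAa.continuousAt.tendsto.comp hc1
    rw [hux, hhx] at h1
    rw [hAx] at h2
    filter_upwards [hequi, (h1.prodMk_nhds (h2.prodMk_nhds hc2)).eventually (Γ'.act_act y hy)]
      with p hp hp'
    simp only [φ, hp.1, hp.2]
    exact hp'.symm
  have hequiv' : ∀ᶠ z in 𝓝 x, ∀ᶠ p : E × (Fin r → 𝕜) in 𝓝 (z, G.one),
      φ (Γ.act p.1 p.2) = Γ'.act (φ p.1) p.2 :=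
    (Continuous.tendsto (f := fun z : E => (z, G.one)) (by fun_prop) x).eventually
      (eventually_eventually_nhds.2 hequiv)
  have hmaps : ∀ᶠ z in 𝓝 x, φ z ∈ Γ'.domain :=
    hφa.continuousAt.eventually_mem (Γ'.isOpen_domain.mem_nhds (by rwa [hφx]))
  obtain ⟨U, hU, hUo, hxU⟩ := eventually_nhds_iff.1
    ((Γ.isOpen_domain.eventually_mem hx).and
      (hφa.eventually_analyticAt.and (hmaps.and (hsurj.and hequiv'))))
  exact ⟨U, φ, hUo, fun z hz => (hU z hz).1, fun z hz => (hU z hz).2.1,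
    fun z hz => (hU z hz).2.2.1, ⟨x, hxU, hφx⟩, fun z hz => (hU z hz).2.2.2.1,
    fun z hz => (hU z hz).2.2.2.2⟩

theorem orbitDeriv_power_apply (Γ : LocalRep G E) {m : ℕ} {x : Fin m → E}
    (hx : ∀ j, x j ∈ Γ.domain) (c : Fin r → 𝕜) (j : Fin m) :
    (Γ.power m).orbitDeriv x c j = Γ.orbitDeriv (x j) c := by
  have h : HasFDerivAt (fun a => (Γ.power m).act x a)
      (ContinuousLinearMap.pi fun j => Γ.orbitDeriv (x j)) G.one :=
    hasFDerivAt_pi.2 fun j => (Γ.analyticAt_orbit (hx j)).differentiableAt.hasFDerivAt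
  rw [orbitDeriv, h.fderiv]
  rfl

theorem orbitDeriv_apply_eq_sum (Γ : LocalRep G E) (x : Γ.domain) (c : Fin r → 𝕜) :
    Γ.orbitDeriv x c = ∑ i, c i • Γ.infOp i x := by
  conv_lhs => rw [pi_eq_sum_univ' c]
  rw [map_sum]
  refine Finset.sum_congr rfl fun i _ => ?_
  rw [map_smul]
  rfl

/-- All sufficiently high powers of a proper representation have an immersed orbit. -/
theorem IsProper.exists_injective_orbitDeriv_power {Γ : LocalRep G E} (hΓ : Γ.IsProper) :
    ∃ p : ℕ, ∀ m ≥ p, ∃ x ∈ (Γ.power m).domain,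
      Function.Injective ((Γ.power m).orbitDeriv x) := by
  obtain ⟨S, hS⟩ := Submodule.exists_finset_inf_le
    fun x : Γ.domain => LinearMap.ker (Γ.orbitDeriv x : (Fin r → 𝕜) →ₗ[𝕜] E)
  refine ⟨S.card, fun m hm => ?_⟩
  obtain ⟨x₀, hx₀⟩ := Γ.nonempty_domain
  -- Surplus copies are filled with an arbitrary point: they cannot enlarge the common kernel.
  let x : Fin m → Γ.domain := fun j =>
    if h : (j : ℕ) < S.card then S.equivFin.symm ⟨j, h⟩ else ⟨x₀, hx₀⟩
  have hxS : ∀ z ∈ S, ∃ j, x j = z := by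
    intro z hz
    refine ⟨⟨S.equivFin ⟨z, hz⟩, (S.equivFin ⟨z, hz⟩).2.trans_le hm⟩, ?_⟩
    simp [x]
  refine ⟨fun j => x j, fun j _ => (x j).2, (injective_iff_map_eq_zero _).2 fun c hc => ?_⟩
  have hcS : c ∈ S.inf fun x : Γ.domain =>
      LinearMap.ker (Γ.orbitDeriv x : (Fin r → 𝕜) →ₗ[𝕜] E) := by
    rw [Submodule.mem_finsetInf]
    intro z hz
    obtain ⟨j, rfl⟩ := hxS z hz
    have := Γ.orbitDeriv_power_apply (x := fun j => (x j : E)) (fun j => (x j).2) c j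
    rw [hc] at this
    exact this.symm
  funext i
  refine Fintype.linearIndependent_iff.1 hΓ c ?_ i
  funext z
  have hz : Γ.orbitDeriv z c = 0 := hS z hcS
  rw [orbitDeriv_apply_eq_sum] at hz
  simpa using hz

end LocalRep

theorem theorem4 {𝕜 : Type*} [RCLike 𝕜] {r n s : ℕ} (hn : 0 < n) (G : LocalLieGroup 𝕜 r)
    (Γ : LocalRep G (Fin n → 𝕜)) (hΓ : Γ.IsProper) (Γ₁ : LocalRep G (Fin s → 𝕜)) :
    ∃ m : ℕ, 0 < m ∧ (Γ.power m).Contains Γ₁ := by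
  obtain ⟨p, hp⟩ := hΓ.exists_injective_orbitDeriv_power
  -- `p` copies secure the immersion; since `n ≥ 1`, `r + s` copies force `dim ker L ≥ s`; the `1`
  -- makes `m` positive.
  refine ⟨p + r + s + 1, by omega, ?_⟩
  obtain ⟨x, hx, hinj⟩ := hp (p + r + s + 1) (by omega)
  generalize hm : p + r + s + 1 = m at *
  obtain ⟨L, hL⟩ := LinearMap.exists_leftInverse_of_injective
    ((Γ.power m).orbitDeriv x : (Fin r → 𝕜) →ₗ[𝕜] Fin m → Fin n → 𝕜)
    (LinearMap.ker_eq_bot.2 hinj)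
  have hdim : Module.finrank 𝕜 (Fin s → 𝕜) ≤ Module.finrank 𝕜 (LinearMap.ker L) := by
    have h1 := L.finrank_range_add_finrank_ker
    have h2 := (LinearMap.range L).finrank_le
    have h3 : m ≤ m * n := Nat.le_mul_of_pos_right m hn
    simp only [Module.finrank_pi_fintype, Module.finrank_self, Finset.sum_const, Finset.card_univ,
      Fintype.card_fin, smul_eq_mul, mul_one] at h1 h2 ⊢
    omega
  obtain ⟨R, hR⟩ := finrank_le_iff_exists_linearMap.1 hdim
  obtain ⟨H, hH⟩ := LinearMap.exists_leftInverse_of_injective ((LinearMap.ker L).subtype ∘ₗ R)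
    (LinearMap.ker_eq_bot.2 (Subtype.val_injective.comp hR))
  refine (Γ.power m).contains_of_transversal hx (LinearMap.toContinuousLinearMap L) ?_
    (LinearMap.toContinuousLinearMap ((LinearMap.ker L).subtype ∘ₗ R))
    (LinearMap.toContinuousLinearMap H) (fun t => (R t).2) (fun t => DFunLike.congr_fun hH t) Γ₁
  ext1 c
  exact DFunLike.congr_fun hL c
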